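/- Let $K$ be a field of characteristic $2$, let $\alpha \in K\setminus\{0\}$, let $E$ be a finite-dimensional $K$-vector space and let $u \in \mathrm{End}(E)$. Call $u$ an $(\alpha,\beta)$-composite if $u=\alpha p+\beta q$ for some idempotents $p,q\in \mathrm{End}(E)$. Write the minimal polynomial of $u$ as $\mu_u=PQ$, where $P$ is a monic product of linear factors $X-\lambda$ with $\lambda\in\{0,\alpha\}$ and $Q$ is monic with no root in $\{0,\alpha\}$, and let $u_{-\{0,\alpha\}}$ be the restriction of $u$ to the $u$-stable subspace $\ker Q(u)$. The elementary factors of an endomorphism $v$ are its nonconstant invariant factors, i.e. the (unique) nonconstant monic polynomials $P_1\mid P_2\mid\dots\mid P_N$ such that $v$ is represented in some basis by the block-diagonal matrix of the companion matrices of $P_1,\dots,P_N$. Then $u$ is an $(\alpha,-\alpha)$-composite (equivalently, an $(\alpha,\alpha)$-composite) if and only if every elementary factor of $u_{-\{0,\alpha\}}$ is an even polynomial, i.e. a polynomial of $X^2$. -/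

import Mathlib

open Polynomial

/-- An element `x` of a `K`-algebra is an `(α, β)`-composite when `x = α • p + β • q` for some
idempotents `p` and `q` of that algebra. -/
def IsComposite {K A : Type*} [Field K] [Ring A] [Algebra K A] (α β : K) (x : A) : Prop :=
  ∃ p q : A, IsIdempotentElem p ∧ IsIdempotentElem q ∧ x = α • p + β • q

section Parts

variable {K E : Type*} [Field K] [AddCommGroup E] [Module K E]

open Classical in
/-- The monic factor of the minimal polynomial of `u` that collects its roots lying in `Λ`
(with multiplicity). It splits over `K` and all its roots are in `Λ`. -/
noncomputable def insidePoly (u : Module.End K E) (Λ : Set K) : K[X] :=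
  (((minpoly K u).roots.filter (fun a => a ∈ Λ)).map (fun a => X - C a)).prod

/-- The complementary factor of the minimal polynomial of `u`, so that
`minpoly K u = insidePoly u Λ * outsidePoly u Λ`. -/
noncomputable def outsidePoly (u : Module.End K E) (Λ : Set K) : K[X] :=
  minpoly K u /ₘ insidePoly u Λ

theorem insidePoly_monic (u : Module.End K E) (Λ : Set K) : (insidePoly u Λ).Monic :=
  monic_multiset_prod_of_monic _ _ fun a _ => monic_X_sub_C a

theorem insidePoly_mul_outsidePoly (u : Module.End K E) (Λ : Set K) :
    insidePoly u Λ * outsidePoly u Λ = minpoly K u := by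
  classical
  have hd : insidePoly u Λ ∣ minpoly K u := by
    refine dvd_trans (Multiset.prod_dvd_prod_of_le (Multiset.map_le_map ?_))
      (prod_multiset_X_sub_C_dvd (minpoly K u))
    exact Multiset.filter_le _ _
  have h := modByMonic_add_div (minpoly K u) (insidePoly u Λ)
  rwa [(modByMonic_eq_zero_iff_dvd (insidePoly_monic u Λ)).2 hd, zero_add] at h

theorem outsidePoly_not_isRoot [FiniteDimensional K E] (u : Module.End K E) (Λ : Set K)
    (a : K) (ha : a ∈ Λ) : ¬ (outsidePoly u Λ).IsRoot a := by
  classical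
  intro hr
  have h0 : minpoly K u ≠ 0 := minpoly.ne_zero (Algebra.IsIntegral.isIntegral u)
  have hm := insidePoly_mul_outsidePoly u Λ
  have hne : insidePoly u Λ * outsidePoly u Λ ≠ 0 := by rwa [hm]
  have hc := congrArg (Multiset.count a) (roots_mul hne)
  have hin : (insidePoly u Λ).roots = (minpoly K u).roots.filter (fun b => b ∈ Λ) := by
    rw [insidePoly, roots_multiset_prod_X_sub_C]
  rw [hm, Multiset.count_add, hin, Multiset.count_filter_of_pos ha] at hc
  have hpos : 0 < Multiset.count a (outsidePoly u Λ).roots :=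
    Multiset.count_pos.2 ((mem_roots (right_ne_zero_of_mul hne)).2 hr)
  omega

/-- The subspace `Ker Q(u)`, where `Q = outsidePoly u Λ`. -/
noncomputable def outsideSpace (u : Module.End K E) (Λ : Set K) : Submodule K E :=
  LinearMap.ker (aeval u (outsidePoly u Λ))

theorem outsideSpace_invariant (u : Module.End K E) (Λ : Set K) :
    ∀ x ∈ outsideSpace u Λ, u x ∈ outsideSpace u Λ := by
  intro x hx
  have hx' : aeval u (outsidePoly u Λ) x = 0 := hx
  have hc : aeval u (outsidePoly u Λ) * u = u * aeval u (outsidePoly u Λ) := by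
    have h := congrArg (aeval u) (mul_comm (outsidePoly u Λ) X)
    simpa only [map_mul, aeval_X] using h
  have h := LinearMap.congr_fun hc x
  change aeval u (outsidePoly u Λ) (u x) = 0
  simpa [Module.End.mul_apply, hx'] using h

/-- The endomorphism `u_{-Λ}`: the restriction of `u` to `Ker Q(u)`, where `Q = outsidePoly u Λ`. -/
noncomputable def outsidePart (u : Module.End K E) (Λ : Set K) :
    Module.End K (outsideSpace u Λ) :=
  u.restrict (outsideSpace_invariant u Λ)

/-- `L = [P₁, …, P_N]` is the list of elementary factors (i.e. nonconstant invariant factors,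
or similarity invariants) of `v`: the `Pᵢ` are monic and nonconstant, each divides the next one,
and the `K[X]`-module in which `X` acts on the underlying space by `v` is isomorphic to
`K[X]/(P₁) × ⋯ × K[X]/(P_N)`; in other words, `v` is represented in some basis by the
block-diagonal matrix whose blocks are the companion matrices of `P₁, …, P_N`. -/
def IsElementaryFactors (v : Module.End K E) (L : List K[X]) : Prop :=
  (∀ P ∈ L, P.Monic ∧ 0 < P.natDegree) ∧
  L.IsChain (fun P Q => P ∣ Q) ∧
  Nonempty (Module.AEval' v ≃ₗ[K[X]] (∀ i : Fin L.length, K[X] ⧸ Ideal.span {L.get i}))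

end Parts

/-- A polynomial is even when it is a polynomial of `X ^ 2`. -/
def IsEvenPoly {K : Type*} [Field K] (P : K[X]) : Prop :=
  ∃ Q : K[X], P = Q.comp (X ^ 2)

/-!
Putting `s = α • p`, the operator `u` is an `(α, -α)`-composite iff the `K[X]`-module in which `X`
acts by `u` carries a connection `s` along the derivation `X (X - α) d/dX` with `s² = α s`. On a
cyclic module `K[X] ⧸ (P)` a connection exists only if `P` divides `X (X - α) P'`; conversely, if it
does, then `s : F ↦ X (X - α) F' + α F` descends to the quotient and satisfies `s² = α s`, because
second derivatives vanish in characteristic `2`. Hence `u` is a composite iff this divisibility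
holds for all the factors `P` of some decomposition of the module into cyclic ones. It is automatic
for a power of a divisor of `X` or of `X - α`, and amounts to `P' = 0` when `P` is coprime to
`X (X - α)`.
-/

section Composite

variable {K A B : Type*} [Field K] [Ring A] [Algebra K A] [Ring B] [Algebra K B] {α β : K}

theorem IsComposite.map {x : A} (h : IsComposite α β x) (f : A →ₐ[K] B) :
    IsComposite α β (f x) := by
  obtain ⟨p, q, hp, hq, rfl⟩ := h
  exact ⟨f p, f q, hp.map f, hq.map f, by simp⟩

theorem isComposite_algEquiv_apply_iff (f : A ≃ₐ[K] B) {x : A} :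
    IsComposite α β (f x) ↔ IsComposite α β x :=
  ⟨fun h => by simpa using h.map f.symm.toAlgHom, fun h => h.map f.toAlgHom⟩

theorem isIdempotentElem_inv_smul_iff (hα : α ≠ 0) {s : A} :
    IsIdempotentElem (α⁻¹ • s) ↔ s * s = α • s := by
  rw [IsIdempotentElem, smul_mul_assoc, mul_smul_comm, smul_right_inj (inv_ne_zero hα),
    inv_smul_eq_iff₀ hα]

theorem isComposite_neg_iff (hα : α ≠ 0) {x : A} :
    IsComposite α (-α) x ↔ ∃ s : A, s * s = α • s ∧ s * x + x * s = x * x + α • x := by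
  -- `s = α • p` and `s - x = α • q`
  have sub_sq_iff {s : A} (hs : s * s = α • s) :
      (s - x) * (s - x) = α • (s - x) ↔ s * x + x * s = x * x + α • x := by
    have h : (s - x) * (s - x) - α • (s - x) = x * x + α • x - (s * x + x * s) := by
      rw [sub_mul, mul_sub, mul_sub, hs, smul_sub]; abel
    rw [← sub_eq_zero, h, sub_eq_zero, eq_comm]
  constructor
  · rintro ⟨p, q, hp, hq, rfl⟩
    have hs : (α • p) * (α • p) = α • α • p := by
      rwa [← isIdempotentElem_inv_smul_iff hα, inv_smul_smul₀ hα]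
    refine ⟨α • p, hs, (sub_sq_iff hs).1 ?_⟩
    rwa [← isIdempotentElem_inv_smul_iff hα, neg_smul, ← sub_eq_add_neg, sub_sub_cancel,
      inv_smul_smul₀ hα]
  · rintro ⟨s, hs, hx⟩
    refine ⟨α⁻¹ • s, α⁻¹ • (s - x), (isIdempotentElem_inv_smul_iff hα).2 hs,
      (isIdempotentElem_inv_smul_iff hα).2 ((sub_sq_iff hs).2 hx), ?_⟩
    rw [neg_smul, smul_inv_smul₀ hα, smul_inv_smul₀ hα, ← sub_eq_add_neg, sub_sub_cancel]

theorem isComposite_iff_lsmul_X {E M : Type*} [AddCommGroup E] [Module K E]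
    [AddCommGroup M] [Module K M] [Module K[X] M] [IsScalarTower K K[X] M] {u : Module.End K E}
    (e : Module.AEval' u ≃ₗ[K[X]] M) :
    IsComposite α β u ↔ IsComposite α β (Algebra.lsmul K K M (X : K[X])) := by
  let ε : E ≃ₗ[K] M := Module.AEval'.of u ≪≫ₗ e.restrictScalars K
  have hε : ε.conjAlgEquiv K u = Algebra.lsmul K K M (X : K[X]) := by
    ext m
    obtain ⟨x, rfl⟩ := ε.surjective m
    simp [ε, ← Module.AEval'.X_smul_of]
  rw [← hε, isComposite_algEquiv_apply_iff]

end Composite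

section Connection

variable {K : Type*} [CommRing K] {M N : Type*} [AddCommGroup M] [Module K M] [Module K[X] M]
  [AddCommGroup N] [Module K N] [Module K[X] N] {w P : K[X]}

/-- `IsConnection w s` says that the `K`-linear operator `s` is a connection on the `K[X]`-module
`M` along the vector field `w · d/dX`, i.e. that it obeys the Leibniz rule for this derivation of
`K[X]`. -/
def IsConnection (w : K[X]) (s : M →ₗ[K] M) : Prop :=
  ∀ (F : K[X]) (m : M), s (F • m) = F • s m + (w * derivative F) • m

theorem isConnection_iff_X_smul [IsScalarTower K K[X] M] {s : M →ₗ[K] M} :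
    IsConnection w s ↔ ∀ m, s ((X : K[X]) • m) = (X : K[X]) • s m + w • m := by
  refine ⟨fun h m => by simpa using h X m, fun h F m => ?_⟩
  induction F using Polynomial.induction_on generalizing m with
  | C a =>
    rw [derivative_C, mul_zero, zero_smul, add_zero, ← algebraMap_eq, algebraMap_smul,
      algebraMap_smul, map_smul]
  | add F G hF hG => simp only [add_smul, map_add, hF, hG, mul_add]; abel
  | monomial n a ih =>
    rw [pow_succ, ← mul_assoc, mul_smul, ih, h, derivative_mul (f := C a * X ^ n), derivative_X]
    module

theorem IsConnection.conj_retraction [IsScalarTower K K[X] M] [IsScalarTower K K[X] N]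
    {s : M →ₗ[K] M} (hs : IsConnection w s) (i : N →ₗ[K[X]] M) (r : M →ₗ[K[X]] N)
    (hri : r ∘ₗ i = LinearMap.id) :
    IsConnection w (r.restrictScalars K ∘ₗ s ∘ₗ i.restrictScalars K) := fun F m => by
  have hm : r (i m) = m := LinearMap.congr_fun hri m
  simp [hs F (i m), hm]

theorem IsConnection.piMap {ι : Type*} {M : ι → Type*} [∀ i, AddCommGroup (M i)]
    [∀ i, Module K (M i)] [∀ i, Module K[X] (M i)] {s : ∀ i, M i →ₗ[K] M i}
    (hs : ∀ i, IsConnection w (s i)) : IsConnection w (LinearMap.piMap s) :=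
  fun F m => funext fun i => hs i F (m i)

theorem IsConnection.mul_derivative_mem_annihilator {s : M →ₗ[K] M} (hs : IsConnection w s)
    {F : K[X]} (hF : F ∈ Module.annihilator K[X] M) :
    w * derivative F ∈ Module.annihilator K[X] M := by
  rw [Module.mem_annihilator] at hF ⊢
  intro m
  simpa only [hF, map_zero, zero_add] using (hs F m).symm

theorem IsConnection.dvd_mul_derivative {s : (K[X] ⧸ Ideal.span {P}) →ₗ[K] K[X] ⧸ Ideal.span {P}}
    (hs : IsConnection w s) : P ∣ w * derivative P := by
  rw [← Ideal.mem_span_singleton, ← Ideal.annihilator_quotient (I := Ideal.span {P})]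
  apply hs.mul_derivative_mem_annihilator
  rw [Ideal.annihilator_quotient]
  exact Ideal.mem_span_singleton_self P

/-- The general connection `F ↦ w F' + c F` on the free module `K[X]`, where `c` is the image
of `1`. -/
noncomputable def polyConnection (w c : K[X]) : K[X] →ₗ[K] K[X] :=
  LinearMap.mulLeft K w ∘ₗ derivative + LinearMap.mulLeft K c

@[simp]
theorem polyConnection_apply (w c F : K[X]) :
    polyConnection w c F = w * derivative F + c * F :=
  rfl

theorem span_le_comap_polyConnection (c : K[X]) (hP : P ∣ w * derivative P) :
    (Ideal.span {P}).restrictScalars K ≤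
      ((Ideal.span {P}).restrictScalars K).comap (polyConnection w c) := by
  intro F hF
  obtain ⟨G, rfl⟩ := Ideal.mem_span_singleton.1 hF
  refine Ideal.mem_span_singleton.2 ?_
  have h : polyConnection w c (P * G) =
      w * derivative P * G + P * (w * derivative G + c * G) := by
    simp only [polyConnection_apply, derivative_mul]; ring
  exact h ▸ dvd_add (hP.mul_right G) (dvd_mul_right P _)

/-- The connection induced by `polyConnection w c` on the cyclic module `K[X] ⧸ (P)`. -/
noncomputable def quotConnection (c : K[X]) (hP : P ∣ w * derivative P) :
    (K[X] ⧸ Ideal.span {P}) →ₗ[K] K[X] ⧸ Ideal.span {P} :=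
  Submodule.mapQ ((Ideal.span {P}).restrictScalars K) ((Ideal.span {P}).restrictScalars K)
    (polyConnection w c) (span_le_comap_polyConnection c hP)

theorem quotConnection_mk (c : K[X]) (hP : P ∣ w * derivative P) (F : K[X]) :
    quotConnection c hP (Ideal.Quotient.mk _ F) = Ideal.Quotient.mk _ (polyConnection w c F) :=
  rfl

theorem isConnection_quotConnection (c : K[X]) (hP : P ∣ w * derivative P) :
    IsConnection w (quotConnection c hP) := fun F m => by
  obtain ⟨G, rfl⟩ := Ideal.Quotient.mk_surjective m
  have smul_mk (A B : K[X]) :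
      A • Ideal.Quotient.mk (Ideal.span {P}) B = Ideal.Quotient.mk _ (A * B) :=
    rfl
  have h : polyConnection w c (F * G) = F * polyConnection w c G + w * derivative F * G := by
    simp only [polyConnection_apply, derivative_mul]; ring
  rw [smul_mk, quotConnection_mk, quotConnection_mk, smul_mk, smul_mk, ← map_add, h]

end Connection

section CharTwo

variable {K : Type*}

theorem derivative_derivative_eq_zero_of_charTwo [CommRing K] [CharP K 2] (F : K[X]) :
    derivative (derivative F) = 0 := by
  have h : Nat.factorial 2 • hasseDeriv 2 F = derivative (derivative F) :=
    congrFun (factorial_smul_hasseDeriv 2) F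
  rw [← h, Nat.factorial_two, two_nsmul, CharTwo.add_self_eq_zero]

theorem polyConnection_polyConnection [CommRing K] [CharP K 2] (α : K) (F : K[X]) :
    polyConnection (X * (X - C α)) (C α) (polyConnection (X * (X - C α)) (C α) F) =
      α • polyConnection (X * (X - C α)) (C α) F := by
  have h2 : (2 : K[X]) = 0 := CharTwo.two_eq_zero
  simp only [polyConnection_apply, derivative_mul, derivative_add, derivative_sub, derivative_C,
    derivative_X, derivative_derivative_eq_zero_of_charTwo, smul_eq_C_mul]
  linear_combination (X ^ 2 * (X - C α) * derivative F) * h2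

theorem quotConnection_quotConnection [CommRing K] [CharP K 2] {α : K} {P : K[X]}
    (hP : P ∣ X * (X - C α) * derivative P) (m : K[X] ⧸ Ideal.span {P}) :
    quotConnection (C α) hP (quotConnection (C α) hP m) = α • quotConnection (C α) hP m := by
  obtain ⟨F, rfl⟩ := Ideal.Quotient.mk_surjective m
  simp only [quotConnection_mk, polyConnection_polyConnection]
  rfl

theorem isEvenPoly_iff_derivative_eq_zero [Field K] [CharP K 2] {P : K[X]} :
    IsEvenPoly P ↔ derivative P = 0 := by
  constructor
  · rintro ⟨Q, rfl⟩
    rw [derivative_comp, derivative_X_pow, Nat.cast_ofNat, CharTwo.two_eq_zero, C_0, zero_mul,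
      zero_mul]
  · intro h
    exact ⟨contract 2 P, by rw [← expand_eq_comp_X_pow, expand_contract 2 h two_ne_zero]⟩

variable [Field K] [CharP K 2] {α : K}

theorem isComposite_lsmul_X_iff (hα : α ≠ 0) {M : Type*} [AddCommGroup M] [Module K M]
    [Module K[X] M] [IsScalarTower K K[X] M] :
    IsComposite α (-α) (Algebra.lsmul K K M (X : K[X])) ↔
      ∃ s : M →ₗ[K] M, (∀ m, s (s m) = α • s m) ∧ IsConnection (X * (X - C α)) s := by
  have neg_eq (m : M) : -m = m := by rw [← neg_one_smul K m, CharTwo.neg_eq, one_smul]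
  rw [isComposite_neg_iff hα]
  refine exists_congr fun s => and_congr LinearMap.ext_iff ?_
  rw [isConnection_iff_X_smul, LinearMap.ext_iff]
  refine forall_congr' fun m => ?_
  have hw : (X * (X - C α)) • m = (X : K[X]) • (X : K[X]) • m + α • (X : K[X]) • m := by
    rw [CharTwo.sub_eq_add, mul_add, add_smul, mul_smul, mul_comm, mul_smul, ← algebraMap_eq,
      algebraMap_smul]
  rw [hw, add_comm _ (_ + _), ← sub_eq_iff_eq_add, sub_eq_add_neg, neg_eq]
  rfl

theorem isComposite_iff_forall_dvd_mul_derivative (hα : α ≠ 0) {E ι : Type*} [AddCommGroup E]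
    [Module K E] {u : Module.End K E} {P : ι → K[X]}
    (e : Module.AEval' u ≃ₗ[K[X]] ∀ i, K[X] ⧸ Ideal.span {P i}) :
    IsComposite α (-α) u ↔ ∀ i, P i ∣ X * (X - C α) * derivative (P i) := by
  classical
  rw [isComposite_iff_lsmul_X e, isComposite_lsmul_X_iff hα]
  constructor
  · rintro ⟨s, -, hs⟩ i
    exact (hs.conj_retraction (LinearMap.single K[X] _ i) (LinearMap.proj i)
      (LinearMap.proj_comp_single_same _ _ i)).dvd_mul_derivative
  · intro hP
    exact ⟨LinearMap.piMap fun i => quotConnection (C α) (hP i),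
      fun m => funext fun i => quotConnection_quotConnection (hP i) (m i),
      IsConnection.piMap fun i => isConnection_quotConnection _ (hP i)⟩

end CharTwo

section InvariantFactors

variable {R : Type*} [CommRing R]

/-- Multiplication by `c` as a map of cyclic modules `R ⧸ (a) → R ⧸ (b)`, which is well defined
when `b` divides `c * a`. -/
def mulQuot (c : R) {a b : R} (h : b ∣ c * a) :
    (R ⧸ Ideal.span {a}) →ₗ[R] R ⧸ Ideal.span {b} :=
  Submodule.mapQ _ _ (LinearMap.mulLeft R c) <|
    (Ideal.span_singleton_le_iff_mem _).2 (Ideal.mem_span_singleton.2 h)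

theorem mulQuot_mk (c : R) {a b : R} (h : b ∣ c * a) (x : R) :
    mulQuot c h (Ideal.Quotient.mk _ x) = Ideal.Quotient.mk _ (c * x) :=
  rfl

theorem nonempty_prod_quot_equiv_gcd_lcm (g : R) {a b : R} (hab : IsCoprime a b) :
    Nonempty (((R ⧸ Ideal.span {g * a}) × (R ⧸ Ideal.span {g * b})) ≃ₗ[R]
      (R ⧸ Ideal.span {g}) × (R ⧸ Ideal.span {g * a * b})) := by
  obtain ⟨s, t, hst⟩ := hab
  -- the matrices `!![s, t; -b, a]` and `!![a, -t; b, s]` are mutually inverse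
  let toGcdLcm := LinearMap.prod
    (LinearMap.coprod (mulQuot s (a := g * a) (b := g) ⟨s * a, by ring⟩)
      (mulQuot t (a := g * b) ⟨t * b, by ring⟩))
    (LinearMap.coprod (mulQuot (-b) (a := g * a) (b := g * a * b) ⟨-1, by ring⟩)
      (mulQuot a (a := g * b) ⟨1, by ring⟩))
  let ofGcdLcm := LinearMap.prod
    (LinearMap.coprod (mulQuot a (a := g) (b := g * a) ⟨1, by ring⟩)
      (mulQuot (-t) (a := g * a * b) ⟨-(t * b), by ring⟩))
    (LinearMap.coprod (mulQuot b (a := g) (b := g * b) ⟨1, by ring⟩)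
      (mulQuot s (a := g * a * b) ⟨s * a, by ring⟩))
  refine ⟨LinearEquiv.ofLinearMap toGcdLcm ofGcdLcm (LinearMap.ext ?_) (LinearMap.ext ?_)⟩ <;>
  · rintro ⟨x, y⟩
    obtain ⟨x, rfl⟩ := Ideal.Quotient.mk_surjective x
    obtain ⟨y, rfl⟩ := Ideal.Quotient.mk_surjective y
    simp only [toGcdLcm, ofGcdLcm, LinearMap.comp_apply, LinearMap.prod_apply, Function.prod,
      LinearMap.coprod_apply, mulQuot_mk, ← map_add, LinearMap.id_apply]
    refine Prod.ext (congrArg (Ideal.Quotient.mk _) ?_) (congrArg (Ideal.Quotient.mk _) ?_)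
    · linear_combination x * hst
    · linear_combination y * hst

/-- The product of the cyclic `R`-modules `R ⧸ (a)`, for `a` in the list `L`; when `L` is a chain
for divisibility, its members are the invariant factors of this module. -/
abbrev CyclicProd (L : List R) : Type _ :=
  ∀ i : Fin L.length, R ⧸ Ideal.span {L.get i}

/-- Splitting off the first factor of a product of cyclic modules. -/
def CyclicProd.consEquiv (a : R) (L : List R) :
    ((R ⧸ Ideal.span {a}) × CyclicProd L) ≃ₗ[R] CyclicProd (a :: L) :=
  Fin.consLinearEquiv R fun i : Fin (L.length + 1) => R ⧸ Ideal.span {(a :: L).get i}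

theorem nonempty_cyclicProd_equiv_filter_not_isUnit [DecidablePred (IsUnit : R → Prop)]
    (L : List R) : Nonempty (CyclicProd L ≃ₗ[R] CyclicProd (L.filter (¬ IsUnit ·))) := by
  induction L with
  | nil => exact ⟨LinearEquiv.refl R _⟩
  | cons a L ih =>
    obtain ⟨e⟩ := ih
    by_cases ha : IsUnit a
    · have : Subsingleton (R ⧸ Ideal.span {a}) :=
        Ideal.Quotient.subsingleton_iff.2 (Ideal.span_singleton_eq_top.2 ha)
      have : Unique (R ⧸ Ideal.span {a}) := Unique.mk' _
      rw [List.filter_cons_of_neg (by simpa using ha)]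
      exact ⟨(CyclicProd.consEquiv a L).symm ≪≫ₗ LinearEquiv.uniqueProd ≪≫ₗ e⟩
    · rw [List.filter_cons_of_pos (by simpa using ha)]
      exact ⟨(CyclicProd.consEquiv a L).symm ≪≫ₗ (LinearEquiv.refl R _).prodCongr e ≪≫ₗ
        CyclicProd.consEquiv a _⟩

theorem nonempty_cyclicProd_equiv_map {f : R → R} (hf : ∀ a, Associated a (f a)) (L : List R) :
    Nonempty (CyclicProd L ≃ₗ[R] CyclicProd (L.map f)) := by
  induction L with
  | nil => exact ⟨LinearEquiv.refl R _⟩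
  | cons a L ih =>
    obtain ⟨e⟩ := ih
    have hspan : Ideal.span {a} = Ideal.span {f a} :=
      le_antisymm (Ideal.span_singleton_le_span_singleton.2 (hf a).dvd')
        (Ideal.span_singleton_le_span_singleton.2 (hf a).dvd)
    exact ⟨(CyclicProd.consEquiv a L).symm ≪≫ₗ
      (Submodule.quotEquivOfEq _ _ hspan).prodCongr e ≪≫ₗ CyclicProd.consEquiv (f a) _⟩

variable [IsDomain R] [IsPrincipalIdealRing R]

theorem exists_pairwise_dvd_insert {L : List R} (a : R) (hL : L.Pairwise (· ∣ ·)) :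
    ∃ L' : List R, L'.Pairwise (· ∣ ·) ∧ (∀ d, d ∣ a → (∀ b ∈ L, d ∣ b) → ∀ b ∈ L', d ∣ b) ∧
      Nonempty (((R ⧸ Ideal.span {a}) × CyclicProd L) ≃ₗ[R] CyclicProd L') := by
  classical
  let _ := IsBezout.toGCDDomain R
  induction L generalizing a with
  | nil => exact ⟨[a], by simp, by simp +contextual, ⟨CyclicProd.consEquiv a []⟩⟩
  | cons b L ih =>
    obtain ⟨hbL, hLtail⟩ := List.pairwise_cons.1 hL
    obtain ⟨a', b', ha, hb, hunit⟩ := extract_gcd a b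
    have hdvd (d : R) (hda : d ∣ a) (hdb : d ∣ b) : d ∣ gcd a b := dvd_gcd hda hdb
    generalize gcd a b = g at ha hb hdvd
    subst ha hb
    obtain ⟨e⟩ := nonempty_prod_quot_equiv_gcd_lcm g ((gcd_isUnit_iff a' b').1 hunit)
    obtain ⟨L', hL', hdvd', ⟨e'⟩⟩ := ih (g * a' * b') hLtail
    refine ⟨g :: L', List.pairwise_cons.2 ⟨?_, hL'⟩, fun d hda hdL => ?_, ⟨?_⟩⟩
    · exact hdvd' g ((dvd_mul_right g a').mul_right b') fun c hc =>
        (dvd_mul_right g b').trans (hbL c hc)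
    · rw [List.forall_mem_cons] at hdL ⊢
      exact ⟨hdvd d hda hdL.1, hdvd' d (hda.mul_right b') hdL.2⟩
    · exact (LinearEquiv.refl R _).prodCongr (CyclicProd.consEquiv (g * b') L).symm ≪≫ₗ
        (LinearEquiv.prodAssoc R _ _ _).symm ≪≫ₗ e.prodCongr (LinearEquiv.refl R _) ≪≫ₗ
        LinearEquiv.prodAssoc R _ _ _ ≪≫ₗ (LinearEquiv.refl R _).prodCongr e' ≪≫ₗ
        CyclicProd.consEquiv g L'

theorem exists_pairwise_dvd_of_fin :
    ∀ {n : ℕ} (a : Fin n → R), ∃ L : List R, L.Pairwise (· ∣ ·) ∧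
      Nonempty ((∀ i, R ⧸ Ideal.span {a i}) ≃ₗ[R] CyclicProd L)
  | 0, _ => ⟨[], .nil, ⟨LinearEquiv.piCongrRight fun i => i.elim0⟩⟩
  | _ + 1, a => by
    obtain ⟨L, hL, ⟨e⟩⟩ := exists_pairwise_dvd_of_fin (Fin.tail a)
    obtain ⟨L', hL', -, ⟨e'⟩⟩ := exists_pairwise_dvd_insert (a 0) hL
    exact ⟨L', hL', ⟨(Fin.consLinearEquiv R fun i => R ⧸ Ideal.span {a i}).symm ≪≫ₗ
      (LinearEquiv.refl R _).prodCongr e ≪≫ₗ e'⟩⟩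

theorem exists_pi_quot_prime_pow_equiv {M : Type*} [AddCommGroup M] [Module R M]
    [Module.Finite R M] (hM : Module.IsTorsion R M) :
    ∃ (n : ℕ) (p : Fin n → R) (k : Fin n → ℕ), (∀ i, Prime (p i)) ∧
      Nonempty (M ≃ₗ[R] ∀ i, R ⧸ Ideal.span {p i ^ k i}) := by
  classical
  obtain ⟨ι, _, p, hp, k, ⟨e⟩⟩ := Module.equiv_directSum_of_isTorsion hM
  let σ := (Fintype.equivFin ι).symm
  exact ⟨_, p ∘ σ, k ∘ σ, fun i => (hp (σ i)).prime,
    ⟨e ≪≫ₗ DirectSum.linearEquivFunOnFintype R ι _ ≪≫ₗ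
      (LinearEquiv.piCongrLeft R (fun i => R ⧸ Ideal.span {p i ^ k i}) σ).symm⟩⟩

theorem exists_pairwise_dvd_equiv {M : Type*} [AddCommGroup M] [Module R M]
    [Module.Finite R M] (hM : Module.IsTorsion R M) :
    ∃ L : List R, L.Pairwise (· ∣ ·) ∧ Nonempty (M ≃ₗ[R] CyclicProd L) := by
  obtain ⟨n, p, k, -, ⟨e⟩⟩ := exists_pi_quot_prime_pow_equiv hM
  obtain ⟨L, hL, ⟨e'⟩⟩ := exists_pairwise_dvd_of_fin fun i => p i ^ k i
  exact ⟨L, hL, ⟨e ≪≫ₗ e'⟩⟩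

end InvariantFactors

section Splitting

variable {K E : Type*} [CommRing K] [AddCommGroup E] [Module K E] {u : Module.End K E}

/-- A decomposition of `E` into two `u`-stable subspaces, as a decomposition of the
`K[X]`-module in which `X` acts on `E` by `u`. -/
noncomputable def aevalProdEquivOfIsCompl {p q : Submodule K E} (h : IsCompl p q)
    (hp : ∀ x ∈ p, u x ∈ p) (hq : ∀ x ∈ q, u x ∈ q) :
    Module.AEval' u ≃ₗ[K[X]] Module.AEval' (u.restrict hp) × Module.AEval' (u.restrict hq) :=
  LinearEquiv.ofAEval u
    ((p.prodEquivOfIsCompl q h).symm ≪≫ₗ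
      (Module.AEval'.of (u.restrict hp)).prodCongr (Module.AEval'.of (u.restrict hq))) fun x => by
    obtain ⟨⟨y, z⟩, rfl⟩ := (p.prodEquivOfIsCompl q h).surjective x
    have hu : u • p.prodEquivOfIsCompl q h (y, z) =
        p.prodEquivOfIsCompl q h (u.restrict hp y, u.restrict hq z) := by simp
    rw [hu, LinearEquiv.trans_apply, LinearEquiv.trans_apply, LinearEquiv.symm_apply_apply,
      LinearEquiv.symm_apply_apply]
    exact Prod.ext (Module.AEval'.X_smul_of (u.restrict hp) y).symm
      (Module.AEval'.X_smul_of (u.restrict hq) z).symm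

theorem ker_aeval_invariant (u : Module.End K E) (F : K[X]) :
    ∀ x ∈ LinearMap.ker (aeval u F), u x ∈ LinearMap.ker (aeval u F) := by
  intro x hx
  have h : aeval u F * aeval u X = aeval u X * aeval u F := (Commute.all F X).map (aeval u)
  rw [aeval_X] at h
  simpa [LinearMap.mem_ker.1 hx] using LinearMap.congr_fun h x

theorem coe_aeval_restrict_apply {p : Submodule K E} (hp : ∀ x ∈ p, u x ∈ p) (F : K[X]) (x : p) :
    (aeval (u.restrict hp : Module.End K p) F x : E) = aeval u F x :=
  let i : Module.AEval' (u.restrict hp) →ₗ[K[X]] Module.AEval' u :=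
    LinearMap.ofAEval _ ((Module.AEval'.of u).toLinearMap ∘ₗ p.subtype) fun x =>
      (Module.AEval'.X_smul_of u (x : E)).symm
  i.map_smul F (Module.AEval'.of _ x)

theorem aeval_restrict_ker_aeval (u : Module.End K E) (F : K[X])
    (h : ∀ x ∈ LinearMap.ker (aeval u F), u x ∈ LinearMap.ker (aeval u F)) :
    aeval (u.restrict h : Module.End K _) F = 0 :=
  LinearMap.ext fun x => Subtype.ext <| (coe_aeval_restrict_apply h F x).trans x.2

theorem dvd_of_aeval_eq_zero {ι : Type*} {P : ι → K[X]}
    (e : Module.AEval' u ≃ₗ[K[X]] ∀ i, K[X] ⧸ Ideal.span {P i}) {F : K[X]} (hF : aeval u F = 0)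
    (i : ι) : P i ∣ F := by
  have h : F ∈ Module.annihilator K[X] (Module.AEval' u) := by
    rwa [Module.AEval.annihilator_eq_ker_aeval, RingHom.mem_ker]
  rw [e.annihilator_eq, Module.annihilator_pi, Submodule.mem_iInf] at h
  simpa only [Ideal.annihilator_quotient, Ideal.mem_span_singleton] using h i

end Splitting

theorem exists_isElementaryFactors {K E : Type*} [Field K] [AddCommGroup E] [Module K E]
    [FiniteDimensional K E] (v : Module.End K E) :
    ∃ L : List K[X], IsElementaryFactors v L := by
  classical
  obtain ⟨L, hL, ⟨e⟩⟩ :=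
    exists_pairwise_dvd_equiv (Module.AEval.isTorsion_of_finiteDimensional K E v)
  obtain ⟨e₁⟩ := nonempty_cyclicProd_equiv_filter_not_isUnit L
  obtain ⟨e₂⟩ := nonempty_cyclicProd_equiv_map (fun a : K[X] => (normalize_associated a).symm)
    (L.filter (¬ IsUnit ·))
  refine ⟨_, fun P hP => ?_, List.Pairwise.isChain ?_, ⟨e ≪≫ₗ e₁ ≪≫ₗ e₂⟩⟩
  · obtain ⟨Q, hQ, rfl⟩ := List.mem_map.1 hP
    obtain ⟨hQL, hQu⟩ := List.mem_filter.1 hQ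
    obtain ⟨i, rfl⟩ := List.get_of_mem hQL
    have hQ0 : L.get i ≠ 0 :=
      ne_zero_of_dvd_ne_zero (minpoly.ne_zero_of_finite K v)
        (dvd_of_aeval_eq_zero e (minpoly.aeval K v) i)
    refine ⟨monic_normalize hQ0, ?_⟩
    rw [natDegree_pos_iff_degree_pos, degree_normalize]
    exact degree_pos_of_ne_zero_of_nonunit hQ0 (by simpa using hQu)
  · exact (hL.filter _).map _ fun a b => by simp [normalize_dvd_iff, dvd_normalize_iff]

section MinpolyFactors

variable {K E : Type*} [Field K] [AddCommGroup E] [Module K E] {u : Module.End K E} {Λ : Set K}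

theorem exists_dvd_X_sub_C_of_prime_of_dvd_insidePoly {p : K[X]} (hp : Prime p)
    (h : p ∣ insidePoly u Λ) : ∃ a ∈ Λ, p ∣ X - C a := by
  classical
  obtain ⟨a, ha, hpa⟩ := hp.exists_mem_multiset_map_dvd h
  exact ⟨a, (Multiset.mem_filter.1 ha).2, hpa⟩

variable [FiniteDimensional K E]

theorem isCoprime_X_sub_C_outsidePoly {a : K} (ha : a ∈ Λ) :
    IsCoprime (X - C a) (outsidePoly u Λ) := by
  rw [(irreducible_X_sub_C a).coprime_iff_not_dvd, dvd_iff_isRoot]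
  exact outsidePoly_not_isRoot u Λ a ha

theorem isCoprime_insidePoly_outsidePoly (u : Module.End K E) (Λ : Set K) :
    IsCoprime (insidePoly u Λ) (outsidePoly u Λ) := by
  refine isCoprime_of_prime_dvd (fun h => (insidePoly_monic u Λ).ne_zero h.1) ?_
  intro p hp hin hout
  obtain ⟨a, ha, hpa⟩ := exists_dvd_X_sub_C_of_prime_of_dvd_insidePoly hp hin
  exact hp.not_isUnit ((isCoprime_X_sub_C_outsidePoly ha).isUnit_of_dvd' hpa hout)

theorem isCompl_ker_aeval_insidePoly_outsideSpace (u : Module.End K E) (Λ : Set K) :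
    IsCompl (LinearMap.ker (aeval u (insidePoly u Λ))) (outsideSpace u Λ) := by
  have h := isCoprime_insidePoly_outsidePoly u Λ
  refine ⟨disjoint_ker_aeval_of_isCoprime u h, codisjoint_iff.2 ?_⟩
  rw [outsideSpace, sup_ker_aeval_eq_ker_aeval_mul_of_coprime u h, insidePoly_mul_outsidePoly,
    minpoly.aeval, LinearMap.ker_zero]

end MinpolyFactors

section Derivative

theorem pow_dvd_mul_derivative_pow {R : Type*} [CommSemiring R] {w P : R[X]}
    (h : P ∣ w) (k : ℕ) : P ^ k ∣ w * derivative (P ^ k) := by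
  obtain _ | k := k
  · simp
  · obtain ⟨v, rfl⟩ := h
    rw [derivative_pow_succ]
    exact ⟨v * (C (k + 1 : R) * derivative P), by ring⟩

theorem dvd_mul_derivative_iff_of_isCoprime {K : Type*} [Field K] {w P : K[X]}
    (h : IsCoprime P w) : P ∣ w * derivative P ↔ derivative P = 0 :=
  ⟨fun hP => dvd_derivative_iff.1 (h.dvd_of_dvd_mul_left hP), fun hP => by simp [hP]⟩

end Derivative

section ZeroAlpha

variable {K E : Type*} [Field K] [AddCommGroup E] [Module K E] {u : Module.End K E} {α : K}

theorem pow_dvd_mul_derivative_of_dvd_insidePoly {p : K[X]} (hp : Prime p) {k : ℕ}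
    (h : p ^ k ∣ insidePoly u {0, α}) : p ^ k ∣ X * (X - C α) * derivative (p ^ k) := by
  obtain rfl | hk := eq_or_ne k 0
  · simp
  refine pow_dvd_mul_derivative_pow ?_ k
  obtain ⟨a, rfl | rfl, ha⟩ :=
    exists_dvd_X_sub_C_of_prime_of_dvd_insidePoly hp ((dvd_pow_self p hk).trans h)
  · rw [C_0, sub_zero] at ha
    exact ha.mul_right _
  · exact ha.mul_left X

theorem dvd_mul_derivative_iff_of_dvd_outsidePoly [FiniteDimensional K E] {P : K[X]}
    (h : P ∣ outsidePoly u {0, α}) :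
    P ∣ X * (X - C α) * derivative P ↔ derivative P = 0 := by
  have h0 : IsCoprime (X - C 0) (outsidePoly u {0, α}) :=
    isCoprime_X_sub_C_outsidePoly (Set.mem_insert 0 _)
  have hα : IsCoprime (X - C α) (outsidePoly u {0, α}) :=
    isCoprime_X_sub_C_outsidePoly (Set.mem_insert_of_mem 0 rfl)
  rw [C_0, sub_zero] at h0
  exact dvd_mul_derivative_iff_of_isCoprime ((h0.mul_left hα).symm.of_isCoprime_of_dvd_left h)

end ZeroAlpha

theorem theorem6_general {K : Type*} [Field K] [CharP K 2] {E : Type*} [AddCommGroup E]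
    [Module K E] [FiniteDimensional K E] {α : K} (hα : α ≠ 0) (u : Module.End K E) {ι : Type*}
    {P : ι → K[X]}
    (e : Module.AEval' (outsidePart u {0, α}) ≃ₗ[K[X]] ∀ i, K[X] ⧸ Ideal.span {P i}) :
    IsComposite α (-α) u ↔ ∀ i, IsEvenPoly (P i) := by
  let insidePart : Module.End K (LinearMap.ker (aeval u (insidePoly u {0, α}))) :=
    u.restrict (ker_aeval_invariant u _)
  have isTorsion : Module.IsTorsion K[X] (Module.AEval' insidePart) :=
    Module.AEval.isTorsion_of_finiteDimensional K _ insidePart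
  obtain ⟨n, p, k, hp, ⟨e'⟩⟩ := exists_pi_quot_prime_pow_equiv isTorsion
  let Q : Fin n ⊕ ι → K[X] := Sum.elim (fun i => p i ^ k i) P
  let f : Module.AEval' u ≃ₗ[K[X]] ∀ i, K[X] ⧸ Ideal.span {Q i} :=
    aevalProdEquivOfIsCompl (isCompl_ker_aeval_insidePoly_outsideSpace u {0, α})
        (ker_aeval_invariant u _) (outsideSpace_invariant u _) ≪≫ₗ e'.prodCongr e ≪≫ₗ
      (LinearEquiv.sumPiEquivProdPi K[X] _ _ fun i => K[X] ⧸ Ideal.span {Q i}).symm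
  have inside_dvd (i : Fin n) : Q (.inl i) ∣ X * (X - C α) * derivative (Q (.inl i)) :=
    pow_dvd_mul_derivative_of_dvd_insidePoly (hp i)
      (dvd_of_aeval_eq_zero e' (aeval_restrict_ker_aeval u _ _) i)
  have outside_iff (i : ι) :
      Q (.inr i) ∣ X * (X - C α) * derivative (Q (.inr i)) ↔ IsEvenPoly (P i) :=
    (dvd_mul_derivative_iff_of_dvd_outsidePoly
      (dvd_of_aeval_eq_zero e (aeval_restrict_ker_aeval u _ _) i)).trans
        isEvenPoly_iff_derivative_eq_zero.symm
  rw [isComposite_iff_forall_dvd_mul_derivative hα f, Sum.forall]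
  exact (and_iff_right inside_dvd).trans (forall_congr' outside_iff)

theorem theorem6 {K : Type*} [Field K] [CharP K 2]
    {E : Type*} [AddCommGroup E] [Module K E] [FiniteDimensional K E]
    (α : K) (hα : α ≠ 0) (u : Module.End K E) :
    (IsComposite α (-α) u ↔ IsComposite α α u) ∧
    (∃ L : List K[X], IsElementaryFactors (outsidePart u {0, α}) L) ∧
    (∀ L : List K[X], IsElementaryFactors (outsidePart u {0, α}) L →
      (IsComposite α (-α) u ↔ ∀ P ∈ L, IsEvenPoly P)) :=
  ⟨by rw [CharTwo.neg_eq], exists_isElementaryFactors _, fun _ ⟨_, _, ⟨e⟩⟩ =>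
    (theorem6_general hα u e).trans List.forall_mem_iff_get.symm⟩
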